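/- Let $A$ be a unital locally $C^*$-algebra, that is, a unital complex $*$-algebra with a family of seminorms $\{P_\alpha\}_{\alpha\in\Delta}$ such that $P_\alpha(ab)\le P_\alpha(a)P_\alpha(b)$, $P_\alpha(a^*)=P_\alpha(a)$ and $P_\alpha(a^*a)=P_\alpha(a)^2$ for all $a,b\in A$ and $\alpha\in\Delta$, and such that $A$ is Hausdorff and complete in the locally convex topology defined by this family. An element $a$ of a unital complex $*$-algebra is called positive, written $a\ge 0$, if $a=a^*$ and its spectrum is contained in $[0,\infty)$. Let $X$ be a Hilbert $A$-module, that is, a right $A$-module (with $\mathbb C$ acting through the unit of $A$) with a map $\langle\cdot,\cdot\rangle:X\times X\to A$ that is additive in the first variable and satisfies, for all $x,y\in X$ and $a\in A$, $\langle xa,y\rangle=\langle x,y\rangle a$, $\langle x,y\rangle^*=\langle y,x\rangle$, $\langle x,x\rangle\ge 0$, and $\langle x,x\rangle=0$ if and only if $x=0$, such that $X$ is complete with respect to the seminorms $\bar P_\alpha(x)=P_\alpha(\langle x,x\rangle)^{1/2}$, $\alpha\in\Delta$. A $\mathbb C$-linear $A$-homomorphism $T:X\to X$ is called bounded if for each $\alpha\in\Delta$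 there is a constant $C_\alpha>0$ with $\bar P_\alpha(Tx)\le C_\alpha\bar P_\alpha(x)$ for all $x\in X$. Let $\mathrm{End}^*_A(X)$ be the unital $*$-algebra of all bounded operators $T$ on $X$ for which there is a bounded operator $T^*$ on $X$ with $\langle Tx,y\rangle=\langle x,T^*y\rangle$ for all $x,y\in X$, with the involution $T\mapsto T^*$. Proposition 3.2. For every $\mathbb C$-linear $A$-homomorphism $T:X\to X$ (not assumed to be bounded or adjointable) the following conditions are equivalent: 1) $T$ belongs to $\mathrm{End}^*_A(X)$ and is a positive element of it; 2) $\langle Tx,x\rangle\ge 0$ in $A$ for every $x\in X$. -/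

import Mathlib

/-- Completeness of the vector space `E` for the uniformity generated by the functions
`x ↦ p i x` (in practice seminorms): every Cauchy filter converges. -/
def SeminormComplete {ι E : Type*} [AddCommGroup E] (p : ι → E → ℝ) : Prop :=
  ∀ F : Filter E, F.NeBot →
    (∀ i, ∀ ε > (0 : ℝ), ∃ S ∈ F, ∀ x ∈ S, ∀ y ∈ S, p i (x - y) < ε) →
    ∃ x : E, ∀ i, Filter.Tendsto (fun y => p i (y - x)) F (nhds 0)

/-- A unital locally C⋆-algebra: a unital complex ⋆-algebra `A` with a separating family
`(P α)` of submultiplicative, ⋆-invariant C⋆-seminorms for which `A` is complete. -/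
class LocallyCStarAlgebra (Δ : outParam Type*) (A : Type*)
    [Ring A] [StarRing A] [Algebra ℂ A] [StarModule ℂ A] where
  P : Δ → Seminorm ℂ A
  P_mul_le : ∀ α a b, P α (a * b) ≤ P α a * P α b
  P_star : ∀ α a, P α (star a) = P α a
  P_star_mul_self : ∀ α a, P α (star a * a) = P α a ^ 2
  separated : ∀ a, (∀ α, P α a = 0) → a = 0
  complete : SeminormComplete (fun α a => P α a)

/-- Positive elements of a unital complex ⋆-algebra: Hermitian with spectrum in `[0, ∞)`. -/
def IsPositiveElement {A : Type*} [Ring A] [StarRing A] [Algebra ℂ A] (a : A) : Prop :=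
  star a = a ∧ spectrum ℂ a ⊆ {z : ℂ | 0 ≤ z.re ∧ z.im = 0}

/-- Pre-Hilbert modules: a right `A`-module `X` (a module over the opposite algebra; the action of
`ℂ` is the one induced by the unit of `A`) with an `A`-valued inner product, `A`-linear in the
first variable. -/
class PreHilbertModule (A X : Type*) [Ring A] [StarRing A] [Algebra ℂ A]
    [AddCommGroup X] [Module ℂ X] [Module Aᵐᵒᵖ X] [IsScalarTower ℂ Aᵐᵒᵖ X] where
  ip : X → X → A
  ip_self_nonneg : ∀ x, IsPositiveElement (ip x x)
  ip_self_eq_zero : ∀ x, ip x x = 0 ↔ x = 0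
  ip_add_left : ∀ x₁ x₂ y, ip (x₁ + x₂) y = ip x₁ y + ip x₂ y
  ip_smul_left : ∀ x y (a : A), ip (MulOpposite.op a • x) y = ip x y * a
  star_ip : ∀ x y, star (ip x y) = ip y x

/-- A submultiplicative seminorm factors through a Banach algebra. -/
theorem exists_banach_of_seminorm.{u} {A : Type u} [Ring A] [Algebra ℂ A] (p : Seminorm ℂ A)
    (hp : ∀ a b, p (a * b) ≤ p a * p b) :
    ∃ (B : Type u) (_ : NormedRing B) (_ : NormedAlgebra ℂ B) (_ : CompleteSpace B)
      (f : A →ₐ[ℂ] B), ∀ a, ‖f a‖ = p a := by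
  let i1 : SeminormedRing A :=
    { ‹Ring A›, p.toAddGroupSeminorm.toSeminormedAddCommGroup with
      norm_mul_le := hp }
  let i2 : NormedAlgebra ℂ A :=
    { ‹Algebra ℂ A› with
      norm_smul_le := fun r x => (map_smul_eq_mul p r x).le }
  let i3 : NormedAlgebra ℂ (UniformSpace.Completion A) := { norm_smul_le := norm_smul_le }
  refine ⟨UniformSpace.Completion A, inferInstance, i3, inferInstance,
    { UniformSpace.Completion.coeRingHom (α := A) with
      commutes' := fun r => rfl }, fun a => ?_⟩
  exact UniformSpace.Completion.norm_coe (E := A) a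

/-- For Hermitian `a`, a C⋆-seminorm is the spectral radius in any Banach algebra through which it
factors. -/
theorem spectralRadius_of_cstarSeminorm {A : Type*} [Ring A] [StarRing A] [Algebra ℂ A]
    (p : Seminorm ℂ A) (hs : ∀ a, p (star a * a) = p a ^ 2) {B : Type*} [NormedRing B]
    [NormedAlgebra ℂ B] [CompleteSpace B] (f : A →ₐ[ℂ] B) (hf : ∀ a, ‖f a‖ = p a) (a : A)
    (ha : star a = a) : spectralRadius ℂ (f a) = ENNReal.ofReal (p a) := by
  have key : ∀ n : ℕ, p (a ^ (2 ^ n)) = p a ^ (2 ^ n) := by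
    intro n
    induction n with
    | zero => simp
    | succ n ih =>
      have h := hs (a ^ (2 ^ n))
      rw [star_pow, ha, ← pow_add, ih] at h
      rw [pow_succ, mul_two, h]
      ring
  have h1 := (spectrum.pow_nnnorm_pow_one_div_tendsto_nhds_spectralRadius (f a)).comp
    (tendsto_pow_atTop_atTop_of_one_lt one_lt_two)
  refine tendsto_nhds_unique h1 ?_
  convert tendsto_const_nhds using 2 with n
  have h2 : (‖f a ^ (2 ^ n)‖₊ : ENNReal) = ENNReal.ofReal (p a) ^ (2 ^ n) := by
    rw [← ENNReal.ofReal_pow (apply_nonneg p a), ← key n, ← hf, map_pow, ofReal_norm]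
    rfl
  simp only [Function.comp_apply]
  rw [h2, ← ENNReal.rpow_natCast, ← ENNReal.rpow_mul]
  simp

/-- C⋆-seminorms are monotone on positive elements. -/
theorem cstarSeminorm_le_add {A : Type*} [Ring A] [StarRing A] [Algebra ℂ A] [StarModule ℂ A]
    (p : Seminorm ℂ A) (hp : ∀ a b, p (a * b) ≤ p a * p b) (hs : ∀ a, p (star a * a) = p a ^ 2)
    {a b : A} (ha : IsPositiveElement a) (hb : IsPositiveElement b) : p a ≤ p (a + b) := by
  obtain ⟨B, _, _, _, f, hf⟩ := exists_banach_of_seminorm p hp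
  rcases subsingleton_or_nontrivial B with hB | hB
  · have : p a = 0 := by rw [← hf, Subsingleton.elim (f a) 0, norm_zero]
    rw [this]; exact apply_nonneg p _
  have pos_spec : ∀ {h : A}, IsPositiveElement h → ∀ z ∈ spectrum ℂ (f h),
      0 ≤ z.re ∧ z.im = 0 := fun {h} hh z hz => hh.2 (AlgHom.spectrum_apply_subset f h hz)
  have star_alg : ∀ r : ℝ, star (algebraMap ℂ A r) = algebraMap ℂ A r := by
    intro r
    rw [Algebra.algebraMap_eq_smul_one, star_smul, star_one]
    simp
  have le_rad : ∀ h : A, star h = h → ∀ z ∈ spectrum ℂ (f h), ‖z‖ ≤ p h := by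
    intro h hh z hz
    have h1 : (‖z‖₊ : ENNReal) ≤ spectralRadius ℂ (f h) :=
      le_iSup₂ (f := fun (k : ℂ) (_ : k ∈ spectrum ℂ (f h)) => (‖k‖₊ : ENNReal)) z hz
    rw [spectralRadius_of_cstarSeminorm p hs f hf h hh] at h1
    have h2 := (ENNReal.toReal_le_toReal (by simp) (by simp)).2 h1
    rwa [ENNReal.toReal_ofReal (apply_nonneg p h)] at h2
  have ex_rad : ∀ h : A, star h = h → ∃ z ∈ spectrum ℂ (f h), ‖z‖ = p h := by
    intro h hh
    obtain ⟨z, hz, e⟩ := spectrum.exists_nnnorm_eq_spectralRadius (f h)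
    refine ⟨z, hz, ?_⟩
    rw [spectralRadius_of_cstarSeminorm p hs f hf h hh] at e
    have h2 := congrArg ENNReal.toReal e
    rwa [ENNReal.toReal_ofReal (apply_nonneg p h)] at h2
  set s : ℝ := p b with hs_def
  have hs0 : 0 ≤ s := apply_nonneg p b
  -- the seminorm of `s - b` is at most `s`
  have c1 : p (algebraMap ℂ A s - b) ≤ s := by
    obtain ⟨z, hz, e⟩ := ex_rad (algebraMap ℂ A s - b) (by rw [star_sub, star_alg, hb.1])
    rw [← e]
    rw [map_sub, AlgHom.commutes, ← spectrum.singleton_sub_eq] at hz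
    obtain ⟨w, rfl, k, hk, rfl⟩ := Set.mem_sub.1 hz
    have hk1 := pos_spec hb k hk
    have hk2 := le_rad b hb.1 k hk
    have hk3 : k = (k.re : ℂ) := Complex.ext (by simp) (by simp [hk1.2])
    have hk4 : k.re ≤ s := (Complex.re_le_norm k).trans hk2
    rw [hk3, ← Complex.ofReal_sub, Complex.norm_real, Real.norm_eq_abs, abs_le]
    constructor <;> linarith [hk1.1]
  -- the seminorm of `a + s` is at least `p a + s`
  have c2 : p a + s ≤ p (a + algebraMap ℂ A s) := by
    obtain ⟨k, hk, e⟩ := ex_rad a ha.1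
    have hk1 := pos_spec ha k hk
    have hk3 : k = (k.re : ℂ) := Complex.ext (by simp) (by simp [hk1.2])
    have hmem : k + (s : ℂ) ∈ spectrum ℂ (f (a + algebraMap ℂ A s)) := by
      rw [map_add, AlgHom.commutes, ← spectrum.add_singleton_eq]
      exact Set.add_mem_add hk rfl
    have h1 := le_rad _ (by rw [star_add, star_alg, ha.1]) _ hmem
    rw [hk3, Complex.norm_real, Real.norm_eq_abs, abs_of_nonneg hk1.1] at e
    rw [hk3, ← Complex.ofReal_add, Complex.norm_real, Real.norm_eq_abs,
      abs_of_nonneg (add_nonneg hk1.1 hs0), e] at h1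
    exact h1
  have c3 : p (a + algebraMap ℂ A s) ≤ p (a + b) + p (algebraMap ℂ A s - b) := by
    have : a + algebraMap ℂ A s = (a + b) + (algebraMap ℂ A s - b) := by abel
    rw [this]; exact map_add_le_add p _ _
  linarith

namespace PreHilbertModule

section Basic

variable {A X : Type*} [Ring A] [StarRing A] [Algebra ℂ A]
    [AddCommGroup X] [Module ℂ X] [Module Aᵐᵒᵖ X] [IsScalarTower ℂ Aᵐᵒᵖ X] [PreHilbertModule A X]

theorem ip_add_right (x y₁ y₂ : X) : (ip x (y₁ + y₂) : A) = ip x y₁ + ip x y₂ := by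
  rw [← star_ip, ip_add_left, star_add, star_ip, star_ip]

theorem ip_neg_left (x y : X) : (ip (-x) y : A) = -ip x y := by
  have h := ip_smul_left (A := A) x y (-1)
  simpa using h

theorem ip_neg_right (x y : X) : (ip x (-y) : A) = -ip x y := by
  rw [← star_ip, ip_neg_left, star_neg, star_ip]

theorem ip_csmul_left (c : ℂ) (x y : X) : (ip (c • x) y : A) = c • ip x y := by
  have h := ip_smul_left (A := A) x y (algebraMap ℂ A c)
  have e : MulOpposite.op (algebraMap ℂ A c) • x = c • x := by
    rw [Algebra.algebraMap_eq_smul_one, MulOpposite.op_smul, smul_assoc, MulOpposite.op_one,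
      one_smul]
  rw [e, ← Algebra.commutes, ← Algebra.smul_def] at h
  exact h

theorem ip_csmul_right [StarModule ℂ A] (c : ℂ) (x y : X) :
    (ip x (c • y) : A) = star c • ip x y := by
  rw [← star_ip, ip_csmul_left, star_smul, star_ip]

theorem ext_ip_right {x y : X} (h : ∀ z : X, (ip z x : A) = ip z y) : x = y := by
  have h1 : (ip (x - y) (x - y) : A) = 0 := by
    have := h (x - y)
    rw [sub_eq_add_neg x y, ip_add_right, ip_neg_right, ← sub_eq_add_neg x y, this, add_neg_cancel]
  exact sub_eq_zero.1 ((ip_self_eq_zero _).1 h1)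

end Basic

section Operators

variable {Δ : Type*} (A : Type*) {X : Type*} [Ring A] [StarRing A] [Algebra ℂ A] [StarModule ℂ A]
    [LocallyCStarAlgebra Δ A]
    [AddCommGroup X] [Module ℂ X] [Module Aᵐᵒᵖ X] [IsScalarTower ℂ Aᵐᵒᵖ X] [PreHilbertModule A X]

/-- The seminorm `x ↦ (P α ⟨x, x⟩)^(1/2)` on `X`. -/
noncomputable def barP (α : Δ) (x : X) : ℝ :=
  Real.sqrt (LocallyCStarAlgebra.P (A := A) α (ip x x))

theorem barP_nonneg (α : Δ) (x : X) : 0 ≤ barP A α x := Real.sqrt_nonneg _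

theorem barP_sq (α : Δ) (x : X) :
    barP A α x ^ 2 = LocallyCStarAlgebra.P (A := A) α (ip x x) :=
  Real.sq_sqrt (apply_nonneg _ _)

theorem barP_smul (α : Δ) (c : ℂ) (x : X) : barP A α (c • x) = ‖c‖ * barP A α x := by
  unfold barP
  rw [ip_csmul_left, ip_csmul_right, map_smul_eq_mul, map_smul_eq_mul, norm_star, ← mul_assoc,
    Real.sqrt_mul (mul_self_nonneg _), Real.sqrt_mul_self (norm_nonneg _)]

/-- A quasi-triangle inequality, enough for sums of bounded operators to be bounded. -/
theorem barP_add_le (α : Δ) (x y : X) : barP A α (x + y) ≤ 2 * (barP A α x + barP A α y) := by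
  have h0 := cstarSeminorm_le_add (LocallyCStarAlgebra.P (A := A) α)
    (LocallyCStarAlgebra.P_mul_le α) (LocallyCStarAlgebra.P_star_mul_self α)
    (ip_self_nonneg (A := A) (x + y)) (ip_self_nonneg (A := A) (x + -y))
  have e : (ip (x + y) (x + y) : A) + ip (x + -y) (x + -y)
      = (ip x x + ip x x) + (ip y y + ip y y) := by
    simp only [ip_add_left, ip_add_right, ip_neg_left, ip_neg_right]
    abel
  rw [e] at h0
  have h1 := map_add_le_add (LocallyCStarAlgebra.P (A := A) α)
    (ip x x + ip x x) (ip y y + ip y y)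
  have h2 := map_add_le_add (LocallyCStarAlgebra.P (A := A) α) (ip x x) (ip x x)
  have h3 := map_add_le_add (LocallyCStarAlgebra.P (A := A) α) (ip y y) (ip y y)
  rw [← barP_sq] at h0 h2 h3
  have hx := barP_nonneg A α x
  have hy := barP_nonneg A α y
  refine abs_le_of_sq_le_sq' ?_ (by positivity) |>.2
  nlinarith [mul_nonneg hx hy]

/-- Bounded module operators. A right `A`-module homomorphism is automatically `ℂ`-linear here, as
`ℂ` acts through `A`. -/
def IsBoundedOperator (T : Module.End Aᵐᵒᵖ X) : Prop :=
  ∀ α : Δ, ∃ C > (0 : ℝ), ∀ x, barP A α (T x) ≤ C * barP A α x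

/-- `S` is an adjoint of `T`. -/
def IsAdjointPair (T S : Module.End Aᵐᵒᵖ X) : Prop :=
  ∀ x y, (ip (T x) y : A) = ip x (S y)

variable {A}

theorem IsAdjointPair.symm {T S : Module.End Aᵐᵒᵖ X} (h : IsAdjointPair A T S) :
    IsAdjointPair A S T := fun x y => by
  rw [← star_ip, ← h, star_ip]

theorem IsAdjointPair.unique {T S S' : Module.End Aᵐᵒᵖ X} (h : IsAdjointPair A T S)
    (h' : IsAdjointPair A T S') : S = S' :=
  LinearMap.ext fun y => ext_ip_right (A := A) fun x => by rw [← h, ← h']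

theorem IsBoundedOperator.add {T S : Module.End Aᵐᵒᵖ X} (hT : IsBoundedOperator A T)
    (hS : IsBoundedOperator A S) : IsBoundedOperator A (T + S) := fun α => by
  obtain ⟨C, hC, h⟩ := hT α
  obtain ⟨D, hD, k⟩ := hS α
  refine ⟨2 * (C + D), by positivity, fun x => ?_⟩
  have := barP_add_le A α (T x) (S x)
  rw [LinearMap.add_apply]
  linarith [h x, k x]

theorem IsBoundedOperator.mul {T S : Module.End Aᵐᵒᵖ X} (hT : IsBoundedOperator A T)
    (hS : IsBoundedOperator A S) : IsBoundedOperator A (T * S) := fun α => by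
  obtain ⟨C, hC, h⟩ := hT α
  obtain ⟨D, hD, k⟩ := hS α
  refine ⟨C * D, by positivity, fun x => (h (S x)).trans ?_⟩
  rw [mul_assoc]
  exact mul_le_mul_of_nonneg_left (k x) hC.le

theorem isBoundedOperator_algebraMap (c : ℂ) :
    IsBoundedOperator A (algebraMap ℂ (Module.End Aᵐᵒᵖ X) c) := fun α =>
  ⟨‖c‖ + 1, by positivity, fun x => by
    rw [Module.algebraMap_end_apply, barP_smul]
    exact mul_le_mul_of_nonneg_right (by linarith) (barP_nonneg A α x)⟩

theorem isAdjointPair_algebraMap (c : ℂ) :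
    IsAdjointPair A (algebraMap ℂ (Module.End Aᵐᵒᵖ X) c)
      (algebraMap ℂ (Module.End Aᵐᵒᵖ X) (star c)) := fun x y => by
  rw [Module.algebraMap_end_apply, Module.algebraMap_end_apply, ip_csmul_left, ip_csmul_right,
    star_star]

theorem IsAdjointPair.add {T S T' S' : Module.End Aᵐᵒᵖ X} (h : IsAdjointPair A T S)
    (h' : IsAdjointPair A T' S') : IsAdjointPair A (T + T') (S + S') := fun x y => by
  rw [LinearMap.add_apply, LinearMap.add_apply, ip_add_left, ip_add_right, h, h']

theorem IsAdjointPair.mul {T S T' S' : Module.End Aᵐᵒᵖ X} (h : IsAdjointPair A T S)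
    (h' : IsAdjointPair A T' S') : IsAdjointPair A (T * T') (S' * S) := fun x y => by
  rw [Module.End.mul_apply, Module.End.mul_apply, h, h']

variable (A X)

/-- The algebra `End*_A(X)` of bounded adjointable operators: those bounded operators which have an
adjoint that is again a bounded operator. -/
def AdjointableEnd : Subalgebra ℂ (Module.End Aᵐᵒᵖ X) where
  carrier := {T | IsBoundedOperator A T ∧ ∃ S, IsBoundedOperator A S ∧ IsAdjointPair A T S}
  mul_mem' := fun ⟨hT, S, hS, h⟩ ⟨hT', S', hS', h'⟩ => ⟨hT.mul hT', S' * S, hS'.mul hS, h.mul h'⟩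
  add_mem' := fun ⟨hT, S, hS, h⟩ ⟨hT', S', hS', h'⟩ => ⟨hT.add hT', S + S', hS.add hS', h.add h'⟩
  algebraMap_mem' := fun c =>
    ⟨isBoundedOperator_algebraMap c, _, isBoundedOperator_algebraMap _, isAdjointPair_algebraMap c⟩

variable {A X}

/-- The involution of `End*_A(X)` sends an operator to its (unique) adjoint. -/
noncomputable instance : Star (AdjointableEnd A X) where
  star T := ⟨T.2.2.choose, T.2.2.choose_spec.1, T.1, T.2.1, T.2.2.choose_spec.2.symm⟩

theorem isAdjointPair_star (T : AdjointableEnd A X) :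
    IsAdjointPair A (T : Module.End Aᵐᵒᵖ X) (star T : AdjointableEnd A X) :=
  T.2.2.choose_spec.2

theorem AdjointableEnd.star_eq {T S : AdjointableEnd A X}
    (h : IsAdjointPair A (T : Module.End Aᵐᵒᵖ X) S) : star T = S :=
  Subtype.ext ((isAdjointPair_star T).unique h)

noncomputable instance : StarRing (AdjointableEnd A X) where
  star_involutive T := AdjointableEnd.star_eq (isAdjointPair_star T).symm
  star_mul T S := AdjointableEnd.star_eq ((isAdjointPair_star T).mul (isAdjointPair_star S))
  star_add T S := AdjointableEnd.star_eq ((isAdjointPair_star T).add (isAdjointPair_star S))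

instance : StarModule ℂ (AdjointableEnd A X) where
  star_smul c T := AdjointableEnd.star_eq fun x y => by
    change (ip (c • (T : Module.End Aᵐᵒᵖ X) x) y : A)
      = ip x (star c • ((star T : AdjointableEnd A X) : Module.End Aᵐᵒᵖ X) y)
    rw [ip_csmul_left, ip_csmul_right, star_star, isAdjointPair_star]

end Operators

end PreHilbertModule

/-- Hilbert modules over a locally C⋆-algebra: pre-Hilbert modules that are complete for the
seminorms `x ↦ (P α ⟨x, x⟩)^(1/2)`. -/
class HilbertModule {Δ : Type*} (A X : Type*) [Ring A] [StarRing A] [Algebra ℂ A] [StarModule ℂ A]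
    [LocallyCStarAlgebra Δ A]
    [AddCommGroup X] [Module ℂ X] [Module Aᵐᵒᵖ X] [IsScalarTower ℂ Aᵐᵒᵖ X]
    extends PreHilbertModule A X where
  complete : SeminormComplete (fun (α : Δ) (x : X) => PreHilbertModule.barP A α x)

/-! Each C⋆-seminorm is the pullback of the norm of a C⋆-algebra, the completion, where order
arguments are available. Homomorphisms shrink spectra, so positivity passes to these completions;
the work lies in carrying it back.

The device for this is the identity |z - a|² = δ + c⋆c + ka, with δ > 0 and k ≥ 0, for Hermitian a
and z outside [0, ∞). If a is positive in every fiber, or has positive form, the right side S is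
bounded below by δ, and 1 - ηS contracts any given seminorm for small η. Completeness then makes S
surjective (`SeminormComplete.surjective`), hence invertible, so z is not in the spectrum. The
argument runs once in `A` and once in X.

Positive form implies positive operator: polarization makes T its own adjoint, and an everywhere
defined adjoint forces boundedness (`IsAdjointPair.isBoundedOperator`). Banach–Steinhaus on the
vectors bounded for all seminorms at once gives a bound by their supremum; replacing x by x(1 + t⟨x,
x⟩)⁻¹ reduces it to a single seminorm. The resolvent device then applies to T.

Positive operator implies positive form: operator seminorms are C⋆-seminorms, so T becomes d⋆d in a
completion of End*_A(X). Approximating d by operators b makes ⟨Tx, x⟩ a limit of the positive ⟨bx,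
bx⟩ in each fiber, and `LocallyCStarAlgebra.isPositiveElement_of_forall_nonneg` returns to `A`. -/

/-! ### C⋆-seminorms and their completions -/

/-- The completion of a ⋆-algebra with a C⋆-seminorm is a C⋆-algebra. -/
noncomputable abbrev UniformSpace.Completion.cstarAlgebra {A : Type*} [SeminormedRing A]
    [StarRing A] [NormedAlgebra ℂ A] [StarModule ℂ A] [NormedStarGroup A]
    (hs : ∀ a : A, ‖star a * a‖ = ‖a‖ * ‖a‖) : CStarAlgebra (UniformSpace.Completion A) :=
  have hc : UniformContinuous (star : A → A) := star_isometry.uniformContinuous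
  letI : Star (UniformSpace.Completion A) := ⟨UniformSpace.Completion.map star⟩
  have hcs : Continuous (star : UniformSpace.Completion A → UniformSpace.Completion A) :=
    UniformSpace.Completion.continuous_map
  have hcoe : ∀ a : A, star (a : UniformSpace.Completion A) = ((star a : A) :) :=
    fun a => UniformSpace.Completion.map_coe hc a
  have hsm : ∀ (c : ℂ) (x : UniformSpace.Completion A), star (c • x) = star c • star x :=
    fun c x => by
      induction x using UniformSpace.Completion.induction_on with
      | hp => exact isClosed_eq (hcs.comp (continuous_const_smul c)) ((continuous_const_smul (star c)).comp hcs)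
      | ih a =>
        rw [hcoe, ← UniformSpace.Completion.coe_smul, hcoe, star_smul,
          UniformSpace.Completion.coe_smul]
  letI : StarRing (UniformSpace.Completion A) :=
    { star_involutive := fun x => by
        induction x using UniformSpace.Completion.induction_on with
        | hp => exact isClosed_eq (hcs.comp hcs) continuous_id
        | ih a => rw [hcoe, hcoe, star_star]
      star_mul := fun x y => by
        induction x, y using UniformSpace.Completion.induction_on₂ with
        | hp => exact isClosed_eq (by fun_prop) (by fun_prop)
        | ih a b =>
          rw [hcoe, hcoe, ← UniformSpace.Completion.coe_mul, hcoe, star_mul,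
            UniformSpace.Completion.coe_mul]
      star_add := fun x y => by
        induction x, y using UniformSpace.Completion.induction_on₂ with
        | hp => exact isClosed_eq (by fun_prop) (by fun_prop)
        | ih a b =>
          rw [hcoe, hcoe, ← UniformSpace.Completion.coe_add, hcoe, star_add,
            UniformSpace.Completion.coe_add] }
  letI : NormedAlgebra ℂ (UniformSpace.Completion A) := { norm_smul_le := norm_smul_le }
  { norm_mul_self_le := fun x => by
      refine le_of_eq ?_
      induction x using UniformSpace.Completion.induction_on with
      | hp => exact isClosed_eq (by fun_prop) (by fun_prop)
      | ih a =>
        rw [hcoe, ← UniformSpace.Completion.coe_mul, UniformSpace.Completion.norm_coe,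
          UniformSpace.Completion.norm_coe, hs]
    star_smul := hsm }

/-- A C⋆-seminorm factors through a C⋆-algebra in which the given algebra has dense image. -/
theorem exists_cstarAlgebra_of_seminorm.{u} {A : Type u} [Ring A] [StarRing A] [Algebra ℂ A]
    [StarModule ℂ A] (p : Seminorm ℂ A) (hp : ∀ a b, p (a * b) ≤ p a * p b)
    (hstar : ∀ a, p (star a) = p a) (hs : ∀ a, p (star a * a) = p a ^ 2) :
    ∃ (B : Type u) (_ : CStarAlgebra B) (_ : PartialOrder B) (_ : StarOrderedRing B)
      (f : A →⋆ₐ[ℂ] B), (∀ a, ‖f a‖ = p a) ∧ DenseRange f := by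
  let i1 : SeminormedRing A :=
    { ‹Ring A›, p.toAddGroupSeminorm.toSeminormedAddCommGroup with
      norm_mul_le := hp }
  let i2 : NormedAlgebra ℂ A :=
    { ‹Algebra ℂ A› with
      norm_smul_le := fun r x => (map_smul_eq_mul p r x).le }
  have i3 : NormedStarGroup A := ⟨fun a => (hstar a).le⟩
  let i4 : CStarAlgebra (UniformSpace.Completion A) :=
    UniformSpace.Completion.cstarAlgebra fun a => (hs a).trans (sq _)
  refine ⟨UniformSpace.Completion A, i4, CStarAlgebra.spectralOrder _,
    CStarAlgebra.spectralOrderedRing _,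
    { UniformSpace.Completion.coeRingHom (α := A) with
      commutes' := fun r => rfl
      map_star' := fun a =>
        (UniformSpace.Completion.map_coe star_isometry.uniformContinuous a).symm },
    fun a => ?_, ?_⟩
  · exact UniformSpace.Completion.norm_coe (E := A) a
  · exact UniformSpace.Completion.denseRange_coe

/-- A ⋆-homomorphism into a C⋆-algebra maps positive elements to positive elements. -/
theorem IsPositiveElement.map_nonneg {A B : Type*} [Ring A] [StarRing A] [Algebra ℂ A]
    [CStarAlgebra B] [PartialOrder B] [StarOrderedRing B] (f : A →⋆ₐ[ℂ] B) {a : A}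
    (ha : IsPositiveElement a) : 0 ≤ f a := by
  have h1 : IsSelfAdjoint (f a) := by rw [IsSelfAdjoint, ← map_star, ha.1]
  rw [StarOrderedRing.nonneg_iff_spectrum_nonneg (R := ℝ) (f a) h1]
  intro r hr
  have h2 : (r : ℂ) ∈ spectrum ℂ (f a) := (spectrum.algebraMap_mem_iff ℂ).2 hr
  simpa using (ha.2 (AlgHom.spectrum_apply_subset f.toAlgHom a h2)).1

/-! ### Surjectivity and uniform boundedness in complete spaces -/

/-- An additive map of a complete space that is bounded below by every seminorm of the family, and
which is made a perturbation of the identity by all small multiples, is surjective. -/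
theorem SeminormComplete.surjective {ι E : Type*} [AddCommGroup E] [Module ℂ E]
    (p : ι → Seminorm ℂ E) (hc : SeminormComplete fun i x => p i x) (hsep : ∀ x, (∀ i, p i x = 0) → x = 0)
    (S : E →ₗ[ℂ] E) {δ : ℝ} (hδ : 0 < δ) (hlow : ∀ i x, δ * p i x ≤ p i (S x))
    (hcon : ∀ i, ∃ C > (0 : ℝ), ∀ η, 0 < η → η ≤ C → ∃ q, 0 ≤ q ∧ q < 1 ∧
      ∀ x, p i (x - (η : ℂ) • S x) ≤ q * p i x) : Function.Surjective S := by
  classical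
  intro y
  choose C hC0 hC using hcon
  -- approximate solutions
  have approx : ∀ (I : Finset ι) (ε : ℝ), 0 < ε → ∃ x, ∀ i ∈ I, p i (S x - y) < ε := by
    intro I ε hε
    -- The bounds `C i` may have no common positive lower bound over all `i`; hence finite sets of
    -- seminorms, and a filter of approximate solutions.
    obtain ⟨η, hη0, hη⟩ : ∃ η > (0 : ℝ), ∀ i ∈ I, η ≤ C i := by
      induction I using Finset.induction_on with
      | empty => exact ⟨1, one_pos, by simp⟩
      | insert i I _ ih =>
        obtain ⟨η, h0, h⟩ := ih
        refine ⟨min η (C i), lt_min h0 (hC0 i), fun j hj => ?_⟩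
        rcases Finset.mem_insert.1 hj with rfl | hj
        · exact min_le_right _ _
        · exact (min_le_left _ _).trans (h j hj)
    -- The iteration x ↦ x + η(y - Sx), started at 0, has residual y - Sx equal to `U^[n] y` after n
    -- steps.
    let U : E → E := fun z => z - (η : ℂ) • S z
    have step : ∀ n : ℕ, ∃ x, y - S x = U^[n] y := by
      intro n
      induction n with
      | zero => exact ⟨0, by simp⟩
      | succ n ih =>
        obtain ⟨x, hx⟩ := ih
        refine ⟨x + (η : ℂ) • U^[n] y, ?_⟩
        rw [Function.iterate_succ_apply', map_add, map_smul, ← sub_sub, hx]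
    have lim : ∀ i ∈ I, ∀ᶠ n : ℕ in Filter.atTop, p i (U^[n] y) < ε := by
      intro i hi
      obtain ⟨q, hq0, hq1, hq⟩ := hC i η hη0 (hη i hi)
      have bd : ∀ n : ℕ, p i (U^[n] y) ≤ q ^ n * p i y := by
        intro n
        induction n with
        | zero => simp
        | succ n ih =>
          rw [Function.iterate_succ_apply', pow_succ', mul_assoc]
          exact (hq _).trans (mul_le_mul_of_nonneg_left ih hq0)
      have ht : Filter.Tendsto (fun n : ℕ => q ^ n * p i y) Filter.atTop (nhds (0 * p i y)) :=
        (tendsto_pow_atTop_nhds_zero_of_lt_one hq0 hq1).mul_const _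
      rw [zero_mul] at ht
      filter_upwards [ht.eventually_lt_const hε] with n hn
      exact (bd n).trans_lt hn
    obtain ⟨n, hn⟩ := ((Filter.eventually_all_finset I).2 lim).exists
    obtain ⟨x, hx⟩ := step n
    exact ⟨x, fun i hi => by rw [map_sub_rev, hx]; exact hn i hi⟩
  -- the filter of approximate solutions
  let F : Filter E := ⨅ k : Finset ι × {ε : ℝ // 0 < ε},
    Filter.principal {x | ∀ i ∈ k.1, p i (S x - y) < k.2}
  have hdir : Directed (· ≥ ·) fun k : Finset ι × {ε : ℝ // 0 < ε} =>
      Filter.principal {x | ∀ i ∈ k.1, p i (S x - y) < k.2} := by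
    rintro ⟨I, ε, hε⟩ ⟨J, ε', hε'⟩
    refine ⟨⟨I ∪ J, min ε ε', lt_min hε hε'⟩, ?_, ?_⟩
    · exact Filter.principal_mono.2 fun x hx i hi =>
        (hx i (Finset.mem_union_left _ hi)).trans_le (min_le_left _ _)
    · exact Filter.principal_mono.2 fun x hx i hi =>
        (hx i (Finset.mem_union_right _ hi)).trans_le (min_le_right _ _)
  have hne : F.NeBot := by
    have : Nonempty (Finset ι × {ε : ℝ // 0 < ε}) := ⟨⟨∅, 1, one_pos⟩⟩
    refine Filter.iInf_neBot_of_directed' hdir fun k => ?_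
    rw [Filter.principal_neBot_iff]
    exact approx k.1 k.2 k.2.2
  have hmem : ∀ i, ∀ ε > (0 : ℝ), {x | p i (S x - y) < ε} ∈ F := fun i ε hε =>
    Filter.mem_of_superset (Filter.mem_iInf_of_mem (⟨{i}, ε, hε⟩ : Finset ι × {ε : ℝ // 0 < ε})
      (Filter.mem_principal_self _)) fun x hx => hx i (Finset.mem_singleton_self i)
  obtain ⟨x, hx⟩ := hc F hne fun i ε hε => by
    -- Two residuals below δε/2 put the images under `S` within δε, so the lower bound δ puts the
    -- points within ε.
    refine ⟨_, hmem i (δ * ε / 2) (by positivity), fun u hu v hv => ?_⟩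
    have h1 : p i (S (u - v)) ≤ p i (S u - y) + p i (S v - y) := by
      rw [map_sub, show S u - S v = (S u - y) - (S v - y) by abel]
      exact map_sub_le_add _ _ _
    have h2 := hlow i (u - v)
    change p i (S _ - y) < _ at hu hv
    nlinarith
  refine ⟨x, sub_eq_zero.1 (hsep _ fun i => ?_)⟩
  obtain ⟨q, -, hq1, hq⟩ := hC i (C i) (hC0 i) le_rfl
  -- `S` is bounded for the seminorm
  have hb : ∀ z, p i (S z) ≤ 2 / C i * p i z := by
    intro z
    -- `C i • S` is the identity minus a contraction, hence bounded by 2.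
    have h1 : p i ((C i : ℂ) • S z) ≤ p i z + p i (z - (C i : ℂ) • S z) := by
      have := map_sub_le_add (p i) z (z - (C i : ℂ) • S z)
      rwa [sub_sub_cancel] at this
    rw [map_smul_eq_mul, Complex.norm_real, Real.norm_of_nonneg (hC0 i).le] at h1
    have h2 := hq z
    have h3 : q * p i z ≤ 1 * p i z := mul_le_mul_of_nonneg_right hq1.le (apply_nonneg _ _)
    rw [div_mul_eq_mul_div, le_div_iff₀ (hC0 i)]
    linarith
  refine le_antisymm (le_of_forall_pos_le_add fun ε hε => ?_) (apply_nonneg _ _)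
  have hxi := ((hx i).const_mul (2 / C i)).eventually_lt_const
    (show 2 / C i * 0 < ε / 2 by simpa using half_pos hε)
  obtain ⟨z, hz1, hz2⟩ := (hxi.and (hmem i (ε / 2) (by positivity))).exists
  have h1 : p i (S x - y) ≤ p i (S (z - x)) + p i (S z - y) := by
    rw [← map_neg_eq_map (p i) (S (z - x)), ← map_neg S, neg_sub, map_sub S,
      show S x - y = (S x - S z) + (S z - y) by abel]
    exact map_add_le_add _ _ _
  have := hb (z - x)
  change p i (S z - y) < ε / 2 at hz2
  linarith

/-! ### Banach–Steinhaus for the supremum of the seminorms -/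

/-- The vectors on which all seminorms of a family are uniformly bounded. -/
def Seminorm.boundedVectors {ι E : Type*} [AddCommGroup E] [Module ℂ E] (p : ι → Seminorm ℂ E) :
    Submodule ℂ E where
  carrier := {x | BddAbove (Set.range fun i => p i x)}
  add_mem' := by
    rintro x y ⟨M, hM⟩ ⟨N, hN⟩
    refine ⟨M + N, ?_⟩
    rintro _ ⟨i, rfl⟩
    exact (map_add_le_add (p i) x y).trans (add_le_add (hM ⟨i, rfl⟩) (hN ⟨i, rfl⟩))
  zero_mem' := ⟨0, by rintro _ ⟨i, rfl⟩; simp⟩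
  smul_mem' := by
    rintro c x ⟨M, hM⟩
    refine ⟨‖c‖ * M, ?_⟩
    rintro _ ⟨i, rfl⟩
    simp only [map_smul_eq_mul]
    exact mul_le_mul_of_nonneg_left (hM ⟨i, rfl⟩) (norm_nonneg c)

/-- A uniform boundedness principle for complete spaces: pointwise bounded linear maps, each
bounded for one of the seminorms, are uniformly bounded on the vectors whose seminorms are all
at most one. -/
theorem SeminormComplete.uniform_bound {ι κ E F : Type*} [AddCommGroup E] [Module ℂ E]
    [NormedAddCommGroup F] [NormedSpace ℂ F]
    (p : ι → Seminorm ℂ E) (hc : SeminormComplete fun i x => p i x)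
    (hsep : ∀ x, (∀ i, p i x = 0) → x = 0) (g : κ → E →ₗ[ℂ] F)
    (hg : ∀ k, ∃ i C, ∀ x, ‖g k x‖ ≤ C * p i x) (hpt : ∀ x, ∃ C, ∀ k, ‖g k x‖ ≤ C) :
    ∃ C, ∀ k x M, 0 ≤ M → (∀ i, p i x ≤ M) → ‖g k x‖ ≤ C * M := by
  let V := Seminorm.boundedVectors p
  let iN : Norm V := ⟨fun x => ⨆ i, p i x⟩
  have hle : ∀ (x : V) i, p i x ≤ ‖x‖ := fun x i => le_ciSup x.2 i
  -- `0 ≤ M` covers an empty family, whose supremum is 0 by convention.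
  have hsup : ∀ (x : V) M, 0 ≤ M → (∀ i, p i x ≤ M) → ‖x‖ ≤ M := fun x M h0 h =>
    Real.iSup_le h h0
  have hnn : ∀ x : V, 0 ≤ ‖x‖ := fun x => Real.iSup_nonneg fun i => apply_nonneg _ _
  have core : NormedSpace.Core ℂ V :=
    { norm_nonneg := hnn
      norm_smul := fun c x => by
        change ⨆ i, p i (c • (x : E)) = ‖c‖ * ⨆ i, p i x
        simp_rw [map_smul_eq_mul]
        exact (Real.mul_iSup_of_nonneg (norm_nonneg c) _).symm
      norm_triangle := fun x y => hsup _ _ (add_nonneg (hnn x) (hnn y)) fun i =>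
        (map_add_le_add (p i) (x : E) y).trans (add_le_add (hle x i) (hle y i))
      norm_eq_zero_iff := fun x => by
        constructor
        · intro h
          exact Subtype.ext (hsep _ fun i => le_antisymm ((hle x i).trans h.le) (apply_nonneg _ _))
        · rintro rfl
          exact le_antisymm (hsup _ _ le_rfl fun i => by simp) (hnn _) }
  let : NormedAddCommGroup V := NormedAddCommGroup.ofCore core
  let : NormedSpace ℂ V := NormedSpace.ofCore core
  have hcomplete : CompleteSpace V := by
    refine Metric.complete_of_cauchySeq_tendsto fun u hu => ?_
    rw [Metric.cauchySeq_iff] at hu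
    simp only [dist_eq_norm] at hu
    obtain ⟨x, hx⟩ := hc (Filter.map (fun n => (u n : E)) Filter.atTop) inferInstance
      fun i ε hε => by
        obtain ⟨N, hN⟩ := hu ε hε
        refine ⟨(fun n => (u n : E)) '' Set.Ici N,
          Filter.image_mem_map (Filter.mem_atTop N), ?_⟩
        rintro _ ⟨n, hn, rfl⟩ _ ⟨m, hm, rfl⟩
        exact (hle (u n - u m) i).trans_lt (hN n hn m hm)
    have hlim : ∀ ε > 0, ∃ N, ∀ n ≥ N, ∀ i, p i (u n - x) ≤ ε := by
      intro ε hε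
      obtain ⟨N, hN⟩ := hu ε hε
      -- The auxiliary index m may depend on `i`, but `N` does not, so the convergence is uniform
      -- over the seminorms.
      refine ⟨N, fun n hn i => le_of_forall_pos_le_add fun η hη => ?_⟩
      have h1 : ∀ᶠ m in Filter.atTop, p i ((u m : E) - x) < η :=
        (Filter.tendsto_map'_iff.1 (hx i)).eventually_lt_const hη
      obtain ⟨m, hm1, hm2⟩ := (h1.and (Filter.eventually_ge_atTop N)).exists
      have h2 := map_add_le_add (p i) ((u n : E) - u m) (u m - x)
      rw [sub_add_sub_cancel] at h2
      have h3 := (hle (u n - u m) i).trans_lt (hN n hn m hm2)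
      have h4 : p i ((u n : E) - u m) < ε := h3
      linarith
    have hxV : x ∈ V := by
      obtain ⟨N, hN⟩ := hlim 1 one_pos
      have h1 : (u N : E) - x ∈ V := ⟨1, by rintro _ ⟨i, rfl⟩; exact hN N le_rfl i⟩
      have h2 := V.sub_mem (u N).2 h1
      rwa [sub_sub_cancel] at h2
    refine ⟨⟨x, hxV⟩, Metric.tendsto_atTop.2 fun ε hε => ?_⟩
    obtain ⟨N, hN⟩ := hlim (ε / 2) (half_pos hε)
    refine ⟨N, fun n hn => ?_⟩
    rw [dist_eq_norm]
    exact (hsup (u n - ⟨x, hxV⟩) _ (half_pos hε).le (hN n hn)).trans_lt (half_lt_self hε)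
  let G : κ → V →L[ℂ] F := fun k => (g k ∘ₗ V.subtype).mkContinuousOfExistsBound (by
    obtain ⟨i, C, h⟩ := hg k
    refine ⟨|C|, fun x => (h x).trans ?_⟩
    exact mul_le_mul (le_abs_self C) (hle x i) (apply_nonneg _ _) (abs_nonneg C))
  obtain ⟨C, hC⟩ := banach_steinhaus (g := G) fun x => hpt x
  refine ⟨C, fun k x M h0 hM => ?_⟩
  have hx : x ∈ V := ⟨M, by rintro _ ⟨i, rfl⟩; exact hM i⟩
  exact (ContinuousLinearMap.le_of_opNorm_le (G k) (hC k) ⟨x, hx⟩).trans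
    (mul_le_mul_of_nonneg_left (hsup ⟨x, hx⟩ M h0 hM) ((norm_nonneg _).trans (hC k)))

/-! ### Resolvents of Hermitian elements -/

/-- A right inverse of a Hermitian element is an inverse. -/
theorem isUnit_of_mul_eq_one_of_star_eq {A : Type*} [Ring A] [StarRing A] {a b : A}
    (ha : star a = a) (h : a * b = 1) : IsUnit a := by
  have h' : star b * a = 1 := by simpa [ha] using congrArg star h
  exact ⟨⟨a, b, h, by rwa [← left_inv_eq_right_inv h' h]⟩, rfl⟩

/-- For Hermitian `a` and `z` outside `[0, ∞)`, the element `|z - a|²` is a sum of a positive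
scalar, a square and a nonnegative multiple of `a`. -/
theorem exists_star_mul_self_resolvent_eq {A : Type*} [Ring A] [StarRing A] [Algebra ℂ A]
    [StarModule ℂ A] {a : A} (ha : star a = a) {z : ℂ} (hz : ¬(0 ≤ z.re ∧ z.im = 0)) :
    ∃ δ > (0 : ℝ), ∃ k ≥ (0 : ℝ), ∃ c : A,
      star (algebraMap ℂ A z - a) * (algebraMap ℂ A z - a)
        = (δ : ℂ) • 1 + star c * c + (k : ℂ) • a := by
  rcases eq_or_ne z.im 0 with h | h
  · have hr : z.re < 0 := not_le.1 fun h' => hz ⟨h', h⟩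
    -- For real r < 0: (r - a)² = r² + a² + (-2r)a.
    refine ⟨z.re ^ 2, by nlinarith, -2 * z.re, by linarith, a, ?_⟩
    have e : z = (z.re : ℂ) := Complex.ext (by simp) (by simp [h])
    rw [e]
    generalize z.re = r
    simp only [Algebra.algebraMap_eq_smul_one, star_sub, star_smul, star_one, ha, Complex.star_def,
      Complex.conj_ofReal, sub_mul, mul_sub, smul_mul_assoc, mul_smul_comm,
      one_mul, mul_one]
    push_cast
    module
  -- Off the real axis: |z - a|² = (Im z)² + (Re z - a)².
  · refine ⟨z.im ^ 2, by positivity, 0, le_rfl, (z.re : ℂ) • 1 - a, ?_⟩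
    have e : z = (z.re : ℂ) + (z.im : ℂ) * Complex.I := (Complex.re_add_im z).symm
    have e2 : star z = (z.re : ℂ) - (z.im : ℂ) * Complex.I :=
      Complex.ext (by simp) (by simp)
    simp only [Algebra.algebraMap_eq_smul_one, star_sub, star_smul, star_one, ha, e2]
    nth_rewrite 3 [e]
    generalize z.re = r, z.im = s
    simp only [Complex.star_def, Complex.conj_ofReal, sub_mul, mul_sub, smul_mul_assoc,
      mul_smul_comm, one_mul, mul_one]
    match_scalars <;> simp
    · ring_nf
      simp
    · ring

/-- If `|z - a|²` is invertible for a Hermitian `a`, then so is `z - a`. -/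
theorem isUnit_resolvent_of_isUnit_star_mul_self {A : Type*} [Ring A] [StarRing A] [Algebra ℂ A]
    [StarModule ℂ A] {a : A} (ha : star a = a) {z : ℂ}
    (h : IsUnit (star (algebraMap ℂ A z - a) * (algebraMap ℂ A z - a))) :
    IsUnit (algebraMap ℂ A z - a) := by
  have hcomm : Commute (star (algebraMap ℂ A z - a)) (algebraMap ℂ A z - a) := by
    rw [star_sub, ha, Algebra.algebraMap_eq_smul_one, star_smul, star_one,
      ← Algebra.algebraMap_eq_smul_one, ← Algebra.algebraMap_eq_smul_one]
    have h1 : ∀ c : ℂ, Commute (algebraMap ℂ A c) a := fun c => Algebra.commutes c a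
    have h2 : Commute (algebraMap ℂ A (star z)) (algebraMap ℂ A z) := Algebra.commutes _ _
    exact (h2.sub_right (h1 _)).sub_left
      ((h1 z).symm.sub_right (Commute.refl a))
  exact (hcomm.isUnit_mul_iff.1 h).2

/-! ### Positivity in `A` tested on fibers -/

namespace LocallyCStarAlgebra

variable {Δ : Type*}

/-- Each seminorm of a locally C⋆-algebra is induced by a C⋆-algebra. -/
theorem exists_cstarAlgebra.{u} {A : Type u} [Ring A] [StarRing A] [Algebra ℂ A] [StarModule ℂ A]
    [LocallyCStarAlgebra Δ A] (α : Δ) :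
    ∃ (B : Type u) (_ : CStarAlgebra B) (_ : PartialOrder B) (_ : StarOrderedRing B)
      (f : A →⋆ₐ[ℂ] B), (∀ a, ‖f a‖ = P α a) ∧ DenseRange f :=
  exists_cstarAlgebra_of_seminorm (P α) (P_mul_le α) (P_star α) (P_star_mul_self α)

/-- A Hermitian element whose images in C⋆-algebras inducing the seminorms are bounded below by
some `δ > 0` is invertible. -/
theorem isUnit_of_forall_le.{u} {A : Type u} [Ring A] [StarRing A] [Algebra ℂ A] [StarModule ℂ A]
    [LocallyCStarAlgebra Δ A] {a : A} (ha : star a = a) {δ : ℝ} (hδ : 0 < δ)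
    (h : ∀ α, ∃ (B : Type u) (_ : CStarAlgebra B) (_ : PartialOrder B) (_ : StarOrderedRing B)
      (f : A →⋆ₐ[ℂ] B), (∀ b, ‖f b‖ = P α b) ∧ algebraMap ℝ B δ ≤ f a) : IsUnit a := by
  have main : ∀ α, ∃ C > (0 : ℝ), ∀ η, 0 < η → η ≤ C →
      0 ≤ 1 - η * δ ∧ P α (1 - (η : ℂ) • a) ≤ 1 - η * δ := by
    intro α
    obtain ⟨B, _, _, _, f, hf, hfa⟩ := h α
    have hsa : IsSelfAdjoint (f a) := by rw [IsSelfAdjoint, ← map_star, ha]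
    -- This bound on η gives 0 ≤ 1 - η f(a) ≤ 1 - ηδ, so the norm is at most 1 - ηδ.
    refine ⟨(‖f a‖ + δ)⁻¹, by positivity, fun η h0 h1 => ?_⟩
    have h2 : η * (‖f a‖ + δ) ≤ 1 := by
      rw [← le_div_iff₀ (by positivity), one_div]; exact h1
    have hq : 0 ≤ 1 - η * δ := by nlinarith [norm_nonneg (f a)]
    refine ⟨hq, ?_⟩
    have e : f (1 - (η : ℂ) • a) = 1 - η • f a := by
      rw [map_sub, map_one, map_smul, Complex.coe_smul]
    have h3 : 0 ≤ 1 - η • f a := by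
      have h5 : η • f a ≤ η • algebraMap ℝ B ‖f a‖ :=
        smul_le_smul_of_nonneg_left hsa.le_algebraMap_norm_self h0.le
      have h6 : η • algebraMap ℝ B ‖f a‖ ≤ 1 := by
        rw [Algebra.smul_def, ← map_mul, ← map_one (algebraMap ℝ B)]
        exact algebraMap_mono B (by nlinarith)
      exact sub_nonneg.2 (h5.trans h6)
    have h4 : 1 - η • f a ≤ algebraMap ℝ B (1 - η * δ) := by
      have h5 : η • algebraMap ℝ B δ ≤ η • f a := smul_le_smul_of_nonneg_left hfa h0.le
      rw [map_sub, map_one, map_mul, ← Algebra.smul_def]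
      exact sub_le_sub_left h5 _
    rw [← hf, e]
    exact (CStarAlgebra.norm_le_iff_le_algebraMap _ hq h3).2 h4
  have con : ∀ α, ∃ C > (0 : ℝ), ∀ η, 0 < η → η ≤ C → 0 ≤ 1 - η * δ ∧
      ∀ x, P α (x - (η : ℂ) • (a * x)) ≤ (1 - η * δ) * P α x := by
    intro α
    obtain ⟨C, hC, h⟩ := main α
    refine ⟨C, hC, fun η h0 h1 => ⟨(h η h0 h1).1, fun x => ?_⟩⟩
    have e : x - (η : ℂ) • (a * x) = (1 - (η : ℂ) • a) * x := by
      rw [sub_mul, one_mul, smul_mul_assoc]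
    rw [e]
    exact (P_mul_le α _ _).trans
      (mul_le_mul_of_nonneg_right (h η h0 h1).2 (apply_nonneg _ _))
  obtain ⟨b, hb⟩ := complete.surjective (P (A := A)) separated (LinearMap.mulLeft ℂ a) hδ
    (fun α x => by
      obtain ⟨C, hC, h⟩ := con α
      have h1 := (h C hC le_rfl).2 x
      -- The lower bound follows from the contraction: P(x) ≤ (1 - Cδ)P(x) + C P(ax).
      have h2 := map_add_le_add (P α) (x - (C : ℂ) • (a * x)) ((C : ℂ) • (a * x))
      rw [sub_add_cancel, map_smul_eq_mul, Complex.norm_real, Real.norm_of_nonneg hC.le] at h2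
      rw [LinearMap.mulLeft_apply]
      nlinarith)
    (fun α => by
      obtain ⟨C, hC, h⟩ := con α
      refine ⟨C, hC, fun η h0 h1 => ⟨1 - η * δ, (h η h0 h1).1, ?_, (h η h0 h1).2⟩⟩
      have := mul_pos h0 hδ
      linarith) 1
  exact isUnit_of_mul_eq_one_of_star_eq ha hb

/-- An element whose images in C⋆-algebras inducing the seminorms are positive is positive. -/
theorem isPositiveElement_of_forall_nonneg.{u} {A : Type u} [Ring A] [StarRing A] [Algebra ℂ A]
    [StarModule ℂ A] [LocallyCStarAlgebra Δ A] {a : A} (ha : star a = a)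
    (h : ∀ α, ∃ (B : Type u) (_ : CStarAlgebra B) (_ : PartialOrder B) (_ : StarOrderedRing B)
      (f : A →⋆ₐ[ℂ] B), (∀ b, ‖f b‖ = P α b) ∧ 0 ≤ f a) : IsPositiveElement a := by
  refine ⟨ha, fun z hz => ?_⟩
  by_contra hz'
  refine hz ?_
  obtain ⟨δ, hδ, k, hk, c, e⟩ := exists_star_mul_self_resolvent_eq ha hz'
  refine isUnit_resolvent_of_isUnit_star_mul_self ha
    (isUnit_of_forall_le (by rw [star_mul, star_star]) hδ fun α => ?_)
  obtain ⟨B, i1, i2, i3, f, hf, hfa⟩ := h α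
  refine ⟨B, i1, i2, i3, f, hf, ?_⟩
  rw [e, map_add, map_add, map_smul, map_smul, map_mul, map_star, map_one, Complex.coe_smul,
    Complex.coe_smul, ← Algebra.algebraMap_eq_smul_one, add_assoc]
  exact le_add_of_nonneg_right (add_nonneg (star_mul_self_nonneg _) (smul_nonneg hk hfa))

end LocallyCStarAlgebra

/-! ### Cauchy–Schwarz and the seminorms of X -/

namespace PreHilbertModule

section Fiber

variable {A X B : Type*} [Ring A] [StarRing A] [Algebra ℂ A] [StarModule ℂ A]
    [AddCommGroup X] [Module ℂ X] [Module Aᵐᵒᵖ X] [IsScalarTower ℂ Aᵐᵒᵖ X] [PreHilbertModule A X]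
    [CStarAlgebra B] [PartialOrder B] [StarOrderedRing B] (f : A →⋆ₐ[ℂ] B)

omit [StarModule ℂ A] in
theorem ip_smul_right (x y : X) (a : A) :
    (ip x (MulOpposite.op a • y) : A) = star a * ip x y := by
  rw [← star_ip, ip_smul_left, star_mul, star_ip]

omit [StarModule ℂ A] in
theorem map_ip_self_nonneg (x : X) : 0 ≤ f (ip x x) :=
  (ip_self_nonneg x).map_nonneg f

/-- The Cauchy–Schwarz inequality in a C⋆-algebra onto which the coefficients are mapped. -/
theorem norm_map_ip_sq_le (x y : X) :
    ‖f (ip x y)‖ ^ 2 ≤ ‖f (ip x x)‖ * ‖f (ip y y)‖ := by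
  -- A strictly larger r is positive and can be cancelled, even when f⟨x, x⟩ = 0; the limit is taken
  -- at the end.
  have key : ∀ r > ‖f (ip x x)‖, ‖f (ip x y)‖ ^ 2 ≤ r * ‖f (ip y y)‖ := by
    intro r hr
    have hr0 : 0 < r := (norm_nonneg _).trans_lt hr
    set b : B := f (ip y x) with hb
    have hbs : star b = f (ip x y) := by rw [hb, ← map_star, star_ip]
    -- The vector x⟨y, x⟩ - ry is the A-valued analogue of the usual minimizing combination.
    have h0 := map_ip_self_nonneg f (MulOpposite.op (ip y x : A) • x + ((-r : ℝ) : ℂ) • y)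
    have e : f (ip (MulOpposite.op (ip y x : A) • x + ((-r : ℝ) : ℂ) • y)
          (MulOpposite.op (ip y x : A) • x + ((-r : ℝ) : ℂ) • y))
        = star b * f (ip x x) * b - (2 * r) • (star b * b) + (r ^ 2) • f (ip y y) := by
      simp only [ip_add_left, ip_add_right, ip_csmul_left, ip_csmul_right, ip_smul_left,
        ip_smul_right, map_add, map_mul, map_smul, map_star, ← hb, hbs,
        Complex.star_def, Complex.conj_ofReal, mul_assoc]
      simp only [Complex.coe_smul, mul_add, mul_smul_comm]
      module
    rw [e] at h0
    have h1 : star b * f (ip x x) * b ≤ ‖f (ip x x)‖ • (star b * b) :=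
      CStarAlgebra.star_left_conjugate_le_norm_smul (.of_nonneg (map_ip_self_nonneg f x))
    have h2 : ‖f (ip x x)‖ • (star b * b) ≤ r • (star b * b) :=
      smul_le_smul_of_nonneg_right hr.le (star_mul_self_nonneg b)
    have h3 : r • (star b * b) ≤ (r ^ 2) • f (ip y y) := by
      have h4 : 0 ≤ r • (star b * b) - (2 * r) • (star b * b) + (r ^ 2) • f (ip y y) :=
        h0.trans (by gcongr; exact h1.trans h2)
      have h5 : r • (star b * b) - (2 * r) • (star b * b) + (r ^ 2) • f (ip y y)
        = (r ^ 2) • f (ip y y) - r • (star b * b) := by module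
      rw [h5] at h4
      exact sub_nonneg.1 h4
    have h4 := CStarAlgebra.norm_le_norm_of_nonneg_of_le
      (smul_nonneg hr0.le (star_mul_self_nonneg b)) h3
    rw [norm_smul, norm_smul, CStarRing.norm_star_mul_self, ← norm_star b, hbs, norm_pow,
      Real.norm_of_nonneg hr0.le] at h4
    nlinarith
  have hc : Filter.Tendsto (fun r : ℝ => r * ‖f (ip y y)‖)
      (nhdsWithin ‖f (ip x x)‖ (Set.Ioi ‖f (ip x x)‖)) (nhds (‖f (ip x x)‖ * ‖f (ip y y)‖)) :=
    ((continuous_id.mul continuous_const).tendsto _).mono_left nhdsWithin_le_nhds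
  exact ge_of_tendsto hc (Filter.eventually_of_mem self_mem_nhdsWithin key)

end Fiber

section Seminorms

variable {Δ A X : Type*} [Ring A] [StarRing A] [Algebra ℂ A] [StarModule ℂ A]
    [LocallyCStarAlgebra Δ A]
    [AddCommGroup X] [Module ℂ X] [Module Aᵐᵒᵖ X] [IsScalarTower ℂ Aᵐᵒᵖ X] [PreHilbertModule A X]

theorem P_ip_le (α : Δ) (x y : X) :
    LocallyCStarAlgebra.P (A := A) α (ip x y) ≤ barP A α x * barP A α y := by
  obtain ⟨B, _, _, _, f, hf, -⟩ := LocallyCStarAlgebra.exists_cstarAlgebra (A := A) α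
  have h := norm_map_ip_sq_le f x y
  rw [hf, hf, hf, ← barP_sq, ← barP_sq, ← mul_pow] at h
  exact abs_le_of_sq_le_sq' h (mul_nonneg (barP_nonneg A α x) (barP_nonneg A α y)) |>.2

variable (A X) in
/-- The function `barP α` as a seminorm. -/
noncomputable def barPSeminorm (α : Δ) : Seminorm ℂ X :=
  Seminorm.of (barP A α) (fun x y => by
    have h1 : barP A α (x + y) ^ 2 ≤ (barP A α x + barP A α y) ^ 2 := by
      rw [barP_sq, ip_add_left, ip_add_right, ip_add_right]
      have h2 := map_add_le_add (LocallyCStarAlgebra.P (A := A) α)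
        (ip x x + ip x y) (ip y x + ip y y)
      have h3 := map_add_le_add (LocallyCStarAlgebra.P (A := A) α) (ip x x) (ip x y)
      have h4 := map_add_le_add (LocallyCStarAlgebra.P (A := A) α) (ip y x) (ip y y)
      have h5 := P_ip_le (A := A) α x y
      have h6 := P_ip_le (A := A) α y x
      rw [← barP_sq] at h3 h4
      nlinarith
    exact abs_le_of_sq_le_sq' h1 (add_nonneg (barP_nonneg A α x) (barP_nonneg A α y)) |>.2)
    (barP_smul A α)

theorem barPSeminorm_apply (α : Δ) (x : X) : barPSeminorm A X α x = barP A α x := rfl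

theorem barP_separated (x : X) (h : ∀ α, barP A α x = 0) : x = 0 :=
  (ip_self_eq_zero (A := A) x).1 (LocallyCStarAlgebra.separated _ fun α => by
    rw [← barP_sq, h, zero_pow two_ne_zero])

theorem barP_smul_le (α : Δ) (x : X) (a : A) :
    barP A α (MulOpposite.op a • x) ≤ barP A α x * LocallyCStarAlgebra.P (A := A) α a := by
  refine abs_le_of_sq_le_sq' ?_ (mul_nonneg (barP_nonneg A α x) (apply_nonneg _ _)) |>.2
  rw [mul_pow, barP_sq, barP_sq, ip_smul_left, ip_smul_right]
  refine (LocallyCStarAlgebra.P_mul_le (A := A) α _ _).trans ?_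
  have h := LocallyCStarAlgebra.P_mul_le (A := A) α (star a) (ip x x)
  rw [LocallyCStarAlgebra.P_star] at h
  nlinarith [apply_nonneg (LocallyCStarAlgebra.P (A := A) α) a]

/-- Multiplying `x` by `(1 + t⟨x, x⟩)⁻¹` makes it uniformly bounded for all seminorms. -/
theorem exists_smul_bounded (x : X) {t : ℝ} (ht : 0 < t) :
    ∃ c : A, c * (1 + (t : ℂ) • ip x x) = 1 ∧
      ∀ β, 4 * t * barP A β (MulOpposite.op c • x) ^ 2 ≤ 1 := by
  set b : A := ip x x with hb
  have hpos : IsPositiveElement b := ip_self_nonneg x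
  have hu : IsUnit (1 + (t : ℂ) • b) := by
    -- Positivity of ⟨x, x⟩ in `A` itself supplies the inverse there: -1/t is not in its spectrum.
    have h1 : -((t : ℂ)⁻¹) ∉ spectrum ℂ b := by
      intro h
      have h2 := (hpos.2 h).1
      rw [← Complex.ofReal_inv, ← Complex.ofReal_neg, Complex.ofReal_re] at h2
      have := inv_pos.2 ht
      linarith
    have h2 : IsUnit (algebraMap ℂ A (-((t : ℂ)⁻¹)) - b) := spectrum.notMem_iff.1 h1
    have h3 : IsUnit (algebraMap ℂ A (-(t : ℂ))) :=
      (IsUnit.mk0 _ (neg_ne_zero.2 (Complex.ofReal_ne_zero.2 ht.ne'))).map _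
    have e : 1 + (t : ℂ) • b = algebraMap ℂ A (-(t : ℂ)) * (algebraMap ℂ A (-((t : ℂ)⁻¹)) - b) := by
      rw [mul_sub, ← map_mul, neg_mul_neg, mul_inv_cancel₀ (Complex.ofReal_ne_zero.2 ht.ne'),
        map_one, map_neg, neg_mul, sub_neg_eq_add, ← Algebra.smul_def]
    rw [e]
    exact h3.mul h2
  obtain ⟨u, hu⟩ := hu
  have hl : (↑u⁻¹ : A) * (1 + (t : ℂ) • b) = 1 := by rw [← hu]; exact u.inv_mul
  have hs : star (1 + (t : ℂ) • b) = 1 + (t : ℂ) • b := by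
    rw [star_add, star_one, star_smul, hpos.1, Complex.star_def, Complex.conj_ofReal]
  have hr : (1 + (t : ℂ) • b) * star (↑u⁻¹ : A) = 1 := by
    have := congrArg star hl
    rwa [star_mul, hs, star_one] at this
  have hcs : star (↑u⁻¹ : A) = ↑u⁻¹ := (left_inv_eq_right_inv hl hr).symm
  rw [hcs] at hr
  refine ⟨↑u⁻¹, hl, fun β => ?_⟩
  generalize (↑u⁻¹ : A) = c at hl hr hcs
  obtain ⟨B, _, _, _, f, hf, -⟩ := LocallyCStarAlgebra.exists_cstarAlgebra (A := A) β
  rw [barP_sq, ip_smul_left, ip_smul_right, ← hb, hcs]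
  -- With c = (1 + tb)⁻¹ this is (1 + tb)² - 4tb = (1 - tb)², multiplied by c on both sides.
  have e1 : (1 : A) - (4 * t : ℂ) • (c * b * c)
      = star ((1 - (t : ℂ) • b) * c) * ((1 - (t : ℂ) • b) * c) := by
    have h1 : (1 : A) = c * (1 + (t : ℂ) • b) * ((1 + (t : ℂ) • b) * c) := by
      rw [hl, hr, one_mul]
    have h2 : star ((1 - (t : ℂ) • b) * c) = c * (1 - (t : ℂ) • b) := by
      rw [star_mul, hcs, star_sub, star_one, star_smul, hpos.1, Complex.star_def,
        Complex.conj_ofReal]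
    rw [h2]
    nth_rewrite 1 [h1]
    simp only [mul_add, add_mul, mul_sub, sub_mul, mul_one, one_mul, smul_mul_assoc,
      mul_smul_comm, mul_assoc]
    module
  have h3 : 0 ≤ f (1 - (4 * t : ℂ) • (c * b * c)) := by
    rw [e1, map_mul, map_star]
    exact star_mul_self_nonneg _
  have h4 : 0 ≤ f (c * b * c) := by
    have : c * b * c = star c * b * c := by rw [hcs]
    rw [this, map_mul, map_mul, map_star]
    exact star_left_conjugate_nonneg (hpos.map_nonneg f) _
  have h5 : (4 * t) • f (c * b * c) ≤ 1 := by
    rw [map_sub, map_one, map_smul, sub_nonneg] at h3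
    rw [← Complex.coe_smul]
    push_cast
    exact h3
  have h6 := (CStarAlgebra.norm_le_one_iff_of_nonneg _
    (smul_nonneg (by positivity : (0 : ℝ) ≤ 4 * t) h4)).2 h5
  rwa [norm_smul, Real.norm_of_nonneg (by positivity), hf] at h6

end Seminorms

end PreHilbertModule

/-! ### From positive forms to positive operators -/

namespace PreHilbertModule

section Operators

variable {Δ A X : Type*} [Ring A] [StarRing A] [Algebra ℂ A] [StarModule ℂ A]
    [LocallyCStarAlgebra Δ A]
    [AddCommGroup X] [Module ℂ X] [Module Aᵐᵒᵖ X] [IsScalarTower ℂ Aᵐᵒᵖ X]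

/-- A Hilbert module homomorphism with an everywhere defined adjoint is bounded. -/
theorem IsAdjointPair.isBoundedOperator [HilbertModule A X] {T S : Module.End Aᵐᵒᵖ X}
    (h : IsAdjointPair A T S) : IsBoundedOperator A T := by
  intro α
  obtain ⟨B, _, _, _, f, hf, -⟩ := LocallyCStarAlgebra.exists_cstarAlgebra (A := A) α
  -- Each `g v` is bounded through ⟨x, Sv⟩; the family is pointwise bounded because this equals ⟨Tx,
  -- v⟩ with v in the unit ball.
  let g : {v : X // barP A α v ≤ 1} → X →ₗ[ℂ] B := fun v =>
    { toFun := fun x => f (ip x (S v))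
      map_add' := fun x y => by rw [ip_add_left, map_add]
      map_smul' := fun c x => by rw [ip_csmul_left, map_smul, RingHom.id_apply] }
  have hg : ∀ v x, ‖g v x‖ = LocallyCStarAlgebra.P (A := A) α (ip x (S v)) := fun v x => hf _
  have hg' : ∀ v x, ‖g v x‖ = LocallyCStarAlgebra.P (A := A) α (ip (T x) v) := fun v x => by
    rw [hg, h]
  obtain ⟨C, hC⟩ := (HilbertModule.complete (A := A) (X := X)).uniform_bound (barPSeminorm A X)
    (barP_separated (A := A)) g
    (fun v => ⟨α, barP A α (S v), fun x => by
      rw [hg, mul_comm]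
      exact P_ip_le α _ _⟩)
    (fun x => ⟨barP A α (T x), fun v => by
      rw [hg']
      exact (P_ip_le α _ _).trans (mul_le_of_le_one_right (barP_nonneg A α _) v.2)⟩)
  -- the operator is bounded on uniformly bounded vectors
  have hT : ∀ x M, 0 ≤ M → (∀ β, barP A β x ≤ M) → barP A α (T x) ≤ |C| * M := by
    intro x M hM0 hM
    rcases (barP_nonneg A α (T x)).eq_or_lt with h0 | h0
    · rw [← h0]; positivity
    · have hv : barP A α ((((barP A α (T x))⁻¹ : ℝ) : ℂ) • T x) ≤ 1 := by
        rw [barP_smul, Complex.norm_real, norm_inv, Real.norm_of_nonneg h0.le,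
          inv_mul_cancel₀ h0.ne']
      have h1 := hC ⟨_, hv⟩ x M hM0 hM
      rw [hg', ip_csmul_right, map_smul_eq_mul, ← barP_sq, norm_star, Complex.norm_real, norm_inv,
        Real.norm_of_nonneg h0.le, sq, inv_mul_cancel_left₀ h0.ne'] at h1
      exact h1.trans (mul_le_mul_of_nonneg_right (le_abs_self C) hM0)
  refine ⟨|C| + 1, by positivity, fun x => ?_⟩
  rcases (barP_nonneg A α x).eq_or_lt with h0 | h0
  · have h1 : barP A α (T x) ^ 2 ≤ 0 := by
      rw [barP_sq, h]
      have := P_ip_le (A := A) α x (S (T x))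
      rwa [← h0, zero_mul] at this
    have h2 : barP A α (T x) = 0 := pow_eq_zero_iff two_ne_zero |>.1 (le_antisymm h1 (sq_nonneg _))
    rw [h2, ← h0, mul_zero]
  · set r := barP A α x with hr
    -- With t = r⁻², every seminorm of xc is at most r/2, while undoing c costs only P(1 + t⟨x, x⟩)
    -- ≤ 2.
    have ht : 0 < (r ^ 2)⁻¹ := by positivity
    obtain ⟨c, hc, hcb⟩ := exists_smul_bounded (A := A) x ht
    have h1 : barP A α (T (MulOpposite.op c • x)) ≤ |C| * (r / 2) :=
      hT _ _ (by positivity) fun β => by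
        have h2 := hcb β
        refine abs_le_of_sq_le_sq' ?_ (by positivity) |>.2
        have h3 : barP A β (MulOpposite.op c • x) ^ 2
            = r ^ 2 / 4 * (4 * (r ^ 2)⁻¹ * barP A β (MulOpposite.op c • x) ^ 2) := by
          field_simp
        rw [h3, div_pow, show (2 : ℝ) ^ 2 = 4 by norm_num]
        exact mul_le_of_le_one_right (by positivity) h2
    have h2 : T x = MulOpposite.op (1 + (((r ^ 2)⁻¹ : ℝ) : ℂ) • ip x x : A) •
        T (MulOpposite.op c • x) := by
      rw [map_smul, smul_smul, ← MulOpposite.op_mul, hc, MulOpposite.op_one, one_smul]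
    have h3 : LocallyCStarAlgebra.P (A := A) α (1 + (((r ^ 2)⁻¹ : ℝ) : ℂ) • ip x x) ≤ 2 := by
      refine (map_add_le_add _ _ _).trans ?_
      rw [map_smul_eq_mul, ← barP_sq, ← hr, Complex.norm_real, Real.norm_of_nonneg ht.le,
        inv_mul_cancel₀ (by positivity)]
      -- P(1) = P(1)² gives P(1) ≤ 1; it may be 0.
      have h4 := LocallyCStarAlgebra.P_star_mul_self α (1 : A)
      rw [star_one, one_mul] at h4
      nlinarith [apply_nonneg (LocallyCStarAlgebra.P (A := A) α) 1]
    rw [h2]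
    refine (barP_smul_le α _ _).trans ?_
    calc _ ≤ |C| * (r / 2) * 2 := mul_le_mul h1 h3 (apply_nonneg _ _) (by positivity)
      _ ≤ (|C| + 1) * r := by linarith

omit [LocallyCStarAlgebra Δ A] in
/-- Polarization: a homomorphism with Hermitian form is its own adjoint. -/
theorem isAdjointPair_self_of_forall_star_eq [PreHilbertModule A X] {T : Module.End Aᵐᵒᵖ X}
    (h : ∀ x, star (ip (T x) x : A) = ip (T x) x) : IsAdjointPair A T T := by
  intro x y
  have key : ∀ u v : X, (ip (T u) v : A) + ip (T v) u = ip u (T v) + ip v (T u) := by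
    intro u v
    have h1 := h (u + v)
    simp only [map_add, ip_add_left, ip_add_right, star_add, h u, h v] at h1
    simp only [star_ip] at h1
    have h2 : (ip (T u) v : A) + ip (T v) u
        = (ip (T u) u + ip (T v) u + (ip (T u) v + ip (T v) v)) - ip (T u) u - ip (T v) v := by abel
    rw [h2, ← h1]
    abel
  have h1 := key x y
  -- Substituting iy and multiplying by i flips the sign of the terms with y moved by T in the first
  -- slot and x in the second; averaging with `h1` isolates ⟨Tx, y⟩ = ⟨x, Ty⟩.
  have h2 := key x (Complex.I • y)
  rw [LinearMap.map_smul_of_tower, ip_csmul_left, ip_csmul_left, ip_csmul_right, ip_csmul_right,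
    Complex.star_def, Complex.conj_I] at h2
  have h3 := congrArg (Complex.I • ·) h2
  simp only [smul_add, neg_smul, smul_neg, smul_smul, Complex.I_mul_I, one_smul, neg_neg] at h3
  linear_combination (norm := module) (1 / 2 : ℂ) • h1 + (1 / 2 : ℂ) • h3

/-- A shift of a form-positive adjointable operator by a positive scalar is invertible in
`End*_A(X)`. -/
theorem AdjointableEnd.isUnit_smul_one_add [HilbertModule A X] {R : AdjointableEnd A X} {δ : ℝ}
    (hδ : 0 < δ) (hR : ∀ x, IsPositiveElement (ip ((R : Module.End Aᵐᵒᵖ X) x) x : A)) :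
    IsUnit ((δ : ℂ) • 1 + R) := by
  set S : AdjointableEnd A X := (δ : ℂ) • 1 + R with hSdef
  let S' : Module.End Aᵐᵒᵖ X := S
  have hSx : ∀ x, S' x = (δ : ℂ) • x + (R : Module.End Aᵐᵒᵖ X) x := fun x => rfl
  have hsymm : IsAdjointPair A S' S' := by
    refine isAdjointPair_self_of_forall_star_eq fun x => ?_
    rw [hSx, ip_add_left, ip_csmul_left, star_add, star_smul, star_ip, (hR x).1,
      Complex.star_def, Complex.conj_ofReal]
  have hlow : ∀ α x, δ * barP A α x ≤ barP A α (S' x) := by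
    intro α x
    obtain ⟨B, _, _, _, f, hf, -⟩ := LocallyCStarAlgebra.exists_cstarAlgebra (A := A) α
    have h1 : δ • f (ip x x) ≤ f (ip (S' x) x) := by
      rw [hSx, ip_add_left, ip_csmul_left, map_add, map_smul, Complex.coe_smul]
      exact le_add_of_nonneg_right ((hR x).map_nonneg f)
    have h2 := CStarAlgebra.norm_le_norm_of_nonneg_of_le
      (smul_nonneg hδ.le (map_ip_self_nonneg f x)) h1
    rw [norm_smul, Real.norm_of_nonneg hδ.le, hf, hf, ← barP_sq] at h2
    have h3 := h2.trans (P_ip_le α (S' x) x)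
    rcases (barP_nonneg A α x).eq_or_lt with h0 | h0
    · rw [← h0, mul_zero]; exact barP_nonneg A α _
    · refine le_of_mul_le_mul_right ?_ h0
      rwa [mul_assoc, ← sq]
  have hcon : ∀ α : Δ, ∃ C > (0 : ℝ), ∀ η, 0 < η → η ≤ C → ∃ q, 0 ≤ q ∧ q < 1 ∧
      ∀ x, barP A α (x - (η : ℂ) • S' x) ≤ q * barP A α x := by
    intro α
    obtain ⟨B, _, _, _, f, hf, -⟩ := LocallyCStarAlgebra.exists_cstarAlgebra (A := A) α
    obtain ⟨K, hK, hSK⟩ := S.2.1 α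
    -- The first bound gives η²‖Sx‖² ≤ ηδ‖x‖², the second 1 - 2ηδ ≥ 0. After dropping -2η⟨Rx, x⟩,
    -- the squared factor is at most 1 - ηδ ≤ (1 - ηδ/2)².
    refine ⟨min (δ / K ^ 2) (1 / (2 * δ)), by positivity, fun η h0 h1 => ?_⟩
    have hη1 : η * K ^ 2 ≤ δ := (le_div_iff₀ (by positivity)).1 (h1.trans (min_le_left _ _))
    have hη2 : η * (2 * δ) ≤ 1 := (le_div_iff₀ (by positivity)).1 (h1.trans (min_le_right _ _))
    have hηδ : 0 < η * δ := mul_pos h0 hδ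
    refine ⟨1 - η * δ / 2, by linarith, by linarith, fun x => ?_⟩
    have e : f (ip (x - (η : ℂ) • S' x) (x - (η : ℂ) • S' x))
        = (1 - η * (2 * δ)) • f (ip x x) + (η ^ 2) • f (ip (S' x) (S' x))
          - (2 * η) • f (ip ((R : Module.End Aᵐᵒᵖ X) x) x) := by
      have e1 : x - (η : ℂ) • S' x = x + ((-η : ℝ) : ℂ) • S' x := by
        push_cast
        rw [neg_smul, sub_eq_add_neg]
      have e2 : f (ip (S' x) x) = δ • f (ip x x) + f (ip ((R : Module.End Aᵐᵒᵖ X) x) x) := by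
        rw [hSx, ip_add_left, ip_csmul_left, map_add, map_smul, Complex.coe_smul]
      rw [e1]
      simp only [ip_add_left, ip_add_right, ip_csmul_left, ip_csmul_right, map_add, map_smul,
        Complex.star_def, Complex.conj_ofReal, ← hsymm x x]
      simp only [Complex.coe_smul, e2]
      module
    have h2 : f (ip (x - (η : ℂ) • S' x) (x - (η : ℂ) • S' x))
        ≤ (1 - η * (2 * δ)) • f (ip x x) + (η ^ 2) • f (ip (S' x) (S' x)) := by
      rw [e]
      exact sub_le_self _ (smul_nonneg (by positivity) ((hR x).map_nonneg f))
    have h3 := (CStarAlgebra.norm_le_norm_of_nonneg_of_le (map_ip_self_nonneg f _) h2).trans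
      (norm_add_le _ _)
    rw [norm_smul, norm_smul, Real.norm_of_nonneg (by linarith), Real.norm_of_nonneg (sq_nonneg η),
      hf, hf, hf, ← barP_sq, ← barP_sq, ← barP_sq] at h3
    refine abs_le_of_sq_le_sq' ?_ (mul_nonneg (by linarith) (barP_nonneg A α x)) |>.2
    have h4 : barP A α (S' x) ^ 2 ≤ K ^ 2 * barP A α x ^ 2 := by
      rw [← mul_pow]
      exact pow_le_pow_left₀ (barP_nonneg A α _) (hSK x) 2
    have h5 : η ^ 2 * barP A α (S' x) ^ 2 ≤ η * δ * barP A α x ^ 2 := by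
      calc _ ≤ η ^ 2 * (K ^ 2 * barP A α x ^ 2) := mul_le_mul_of_nonneg_left h4 (sq_nonneg η)
        _ = η * (η * K ^ 2) * barP A α x ^ 2 := by ring
        _ ≤ _ := by gcongr
    nlinarith [mul_nonneg (sq_nonneg (η * δ)) (sq_nonneg (barP A α x))]
  have hsurj : Function.Surjective S' :=
    (HilbertModule.complete (A := A) (X := X)).surjective (barPSeminorm A X)
      (barP_separated (A := A)) (S'.restrictScalars ℂ) hδ hlow hcon
  have hinj : Function.Injective S' := by
    refine (injective_iff_map_eq_zero S').2 fun x hx => barP_separated (A := A) x fun α => ?_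
    have h1 := hlow α x
    rw [hx, ← barPSeminorm_apply, ← barPSeminorm_apply, map_zero] at h1
    exact le_antisymm (by
      rw [← barPSeminorm_apply]
      nlinarith [apply_nonneg (barPSeminorm A X α) x]) (barP_nonneg A α x)
  let e := LinearEquiv.ofBijective S' ⟨hinj, hsurj⟩
  let V : Module.End Aᵐᵒᵖ X := e.symm
  have hSV : ∀ x, S' (V x) = x := e.apply_symm_apply
  have hVS : ∀ x, V (S' x) = x := e.symm_apply_apply
  have hVb : IsBoundedOperator A V := fun α => ⟨δ⁻¹, inv_pos.2 hδ, fun x => by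
    have h1 := hlow α (V x)
    rw [hSV] at h1
    rwa [inv_mul_eq_div, le_div_iff₀ hδ, mul_comm]⟩
  have hVV : IsAdjointPair A V V := fun x y => by
    nth_rewrite 1 [← hSV y]
    rw [← hsymm, hSV]
  exact ⟨⟨S, ⟨V, hVb, V, hVb, hVV⟩, Subtype.ext (LinearMap.ext hSV),
    Subtype.ext (LinearMap.ext hVS)⟩, rfl⟩

/-- Homomorphisms with positive form are positive elements of `End*_A(X)`. -/
theorem isPositiveElement_of_forall_ip [HilbertModule A X] {T : Module.End Aᵐᵒᵖ X}
    (h : ∀ x, IsPositiveElement (ip (T x) x : A)) :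
    ∃ hT : T ∈ AdjointableEnd A X, IsPositiveElement (⟨T, hT⟩ : AdjointableEnd A X) := by
  have hsymm : IsAdjointPair A T T := isAdjointPair_self_of_forall_star_eq fun x => (h x).1
  have hb := hsymm.isBoundedOperator
  have hT : T ∈ AdjointableEnd A X := ⟨hb, T, hb, hsymm⟩
  have hstar : star (⟨T, hT⟩ : AdjointableEnd A X) = ⟨T, hT⟩ := AdjointableEnd.star_eq hsymm
  refine ⟨hT, hstar, fun z hz => ?_⟩
  by_contra hz'
  refine hz ?_
  obtain ⟨δ, hδ, k, hk, c, e⟩ := exists_star_mul_self_resolvent_eq (A := AdjointableEnd A X) hstar hz'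
  refine isUnit_resolvent_of_isUnit_star_mul_self (A := AdjointableEnd A X) hstar ?_
  rw [e, add_assoc]
  refine AdjointableEnd.isUnit_smul_one_add hδ fun x => ?_
  have e1 : (ip (((star c * c + (k : ℂ) • (⟨T, hT⟩ : AdjointableEnd A X) : AdjointableEnd A X) :
      Module.End Aᵐᵒᵖ X) x) x : A)
      = ip ((c : Module.End Aᵐᵒᵖ X) x) ((c : Module.End Aᵐᵒᵖ X) x) + (k : ℂ) • ip (T x) x := by
    change (ip (((star c : AdjointableEnd A X) : Module.End Aᵐᵒᵖ X)
      ((c : Module.End Aᵐᵒᵖ X) x) + (k : ℂ) • T x) x : A) = _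
    rw [ip_add_left, ip_csmul_left, (isAdjointPair_star c).symm]
  rw [e1]
  -- Sums of positive elements are not evidently positive under the spectral definition, so this is
  -- checked in the fibers.
  refine LocallyCStarAlgebra.isPositiveElement_of_forall_nonneg ?_ fun α => ?_
  · rw [star_add, star_smul, star_ip, (h x).1, Complex.star_def, Complex.conj_ofReal]
  · obtain ⟨B, i1, i2, i3, f, hf, -⟩ := LocallyCStarAlgebra.exists_cstarAlgebra (A := A) α
    refine ⟨B, i1, i2, i3, f, hf, ?_⟩
    rw [map_add, map_smul, Complex.coe_smul]
    exact add_nonneg (map_ip_self_nonneg f _) (smul_nonneg hk ((h x).map_nonneg f))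

end Operators

end PreHilbertModule

/-! ### From positive operators to positive forms -/

namespace PreHilbertModule

namespace AdjointableEnd

variable {Δ A X : Type*} [Ring A] [StarRing A] [Algebra ℂ A] [StarModule ℂ A]
    [LocallyCStarAlgebra Δ A]
    [AddCommGroup X] [Module ℂ X] [Module Aᵐᵒᵖ X] [IsScalarTower ℂ Aᵐᵒᵖ X] [PreHilbertModule A X]

/-- The least bound of an operator for the seminorm `barP α`. -/
noncomputable def opBound (α : Δ) (T : AdjointableEnd A X) : ℝ :=
  sInf {C | 0 ≤ C ∧ ∀ x, barP A α ((T : Module.End Aᵐᵒᵖ X) x) ≤ C * barP A α x}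

theorem opBound_nonneg (α : Δ) (T : AdjointableEnd A X) : 0 ≤ opBound α T :=
  Real.sInf_nonneg fun _ h => h.1

theorem opBound_le (α : Δ) {T : AdjointableEnd A X} {C : ℝ} (h0 : 0 ≤ C)
    (h : ∀ x, barP A α ((T : Module.End Aᵐᵒᵖ X) x) ≤ C * barP A α x) : opBound α T ≤ C :=
  csInf_le ⟨0, fun _ h => h.1⟩ ⟨h0, h⟩

/-- The infimum is attained: divide by `barP A α x`, or use any bound when this vanishes. -/
theorem le_opBound (α : Δ) (T : AdjointableEnd A X) (x : X) :
    barP A α ((T : Module.End Aᵐᵒᵖ X) x) ≤ opBound α T * barP A α x := by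
  obtain ⟨K, hK, hT⟩ := T.2.1 α
  rcases (barP_nonneg A α x).eq_or_lt with h0 | h0
  · have := hT x
    rwa [← h0, mul_zero] at this ⊢
  · rw [← div_le_iff₀ h0]
    exact le_csInf ⟨K, hK.le, hT⟩ fun C hC => (div_le_iff₀ h0).2 (hC.2 x)

variable (A X) in
/-- The operator seminorm on `End*_A(X)` for the seminorm `barP α`. -/
noncomputable def opSeminorm (α : Δ) : Seminorm ℂ (AdjointableEnd A X) :=
  Seminorm.ofSMulLE (opBound α)
    (le_antisymm (opBound_le α le_rfl fun x => by
      rw [zero_mul]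
      exact (map_zero (barPSeminorm A X α)).le) (opBound_nonneg α 0))
    (fun T S => opBound_le α (add_nonneg (opBound_nonneg α T) (opBound_nonneg α S)) fun x => by
      rw [add_mul]
      exact (map_add_le_add (barPSeminorm A X α) _ _).trans
        (add_le_add (le_opBound α T x) (le_opBound α S x)))
    (fun c T => opBound_le α (mul_nonneg (norm_nonneg c) (opBound_nonneg α T)) fun x => by
      rw [mul_assoc]
      exact (barP_smul A α c _).le.trans
        (mul_le_mul_of_nonneg_left (le_opBound α T x) (norm_nonneg c)))

theorem opBound_mul_le (α : Δ) (T S : AdjointableEnd A X) :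
    opBound α (T * S) ≤ opBound α T * opBound α S :=
  opBound_le α (mul_nonneg (opBound_nonneg α T) (opBound_nonneg α S)) fun x => by
    rw [mul_assoc]
    exact (le_opBound α T _).trans
      (mul_le_mul_of_nonneg_left (le_opBound α S x) (opBound_nonneg α T))

/-- ⟨Tx, Tx⟩ = ⟨T⋆Tx, x⟩, followed by Cauchy–Schwarz. -/
theorem opBound_sq_le (α : Δ) (T : AdjointableEnd A X) :
    opBound α T ^ 2 ≤ opBound α (star T * T) := by
  have h : opBound α T ≤ Real.sqrt (opBound α (star T * T)) :=
    opBound_le α (Real.sqrt_nonneg _) fun x => by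
      refine abs_le_of_sq_le_sq' ?_ (mul_nonneg (Real.sqrt_nonneg _) (barP_nonneg A α x)) |>.2
      rw [mul_pow, Real.sq_sqrt (opBound_nonneg α _), barP_sq, ← (isAdjointPair_star T).symm, sq,
        ← mul_assoc]
      exact (P_ip_le α _ _).trans
        (mul_le_mul_of_nonneg_right (le_opBound α (star T * T) x) (barP_nonneg A α x))
  exact (pow_le_pow_left₀ (opBound_nonneg α T) h 2).trans (Real.sq_sqrt (opBound_nonneg α _)).le

/-- Cancel one factor in ‖S‖² ≤ ‖S⋆S‖ ≤ ‖S⋆‖‖S‖, then apply this to S and to S⋆. -/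
theorem opBound_star (α : Δ) (T : AdjointableEnd A X) : opBound α (star T) = opBound α T := by
  have key : ∀ S : AdjointableEnd A X, opBound α S ≤ opBound α (star S) := by
    intro S
    have h := (opBound_sq_le α S).trans (opBound_mul_le α (star S) S)
    rcases (opBound_nonneg α S).eq_or_lt with h0 | h0
    · rw [← h0]; exact opBound_nonneg α _
    · rw [sq] at h
      exact le_of_mul_le_mul_right h h0
  refine le_antisymm ?_ (key T)
  have := key (star T)
  rwa [star_star] at this

theorem opBound_star_mul_self (α : Δ) (T : AdjointableEnd A X) :
    opBound α (star T * T) = opBound α T ^ 2 := by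
  refine le_antisymm ?_ (opBound_sq_le α T)
  have := opBound_mul_le α (star T) T
  rwa [opBound_star, ← sq] at this

/-- The form of a positive operator is positive. -/
theorem isPositiveElement_ip {T : AdjointableEnd A X} (hT : IsPositiveElement T) (x : X) :
    IsPositiveElement (ip ((T : Module.End Aᵐᵒᵖ X) x) x : A) := by
  refine LocallyCStarAlgebra.isPositiveElement_of_forall_nonneg ?_ fun α => ?_
  · have h := isAdjointPair_star T
    rw [hT.1] at h
    rw [star_ip, ← h]
  obtain ⟨B, i1, i2, i3, f, hf, -⟩ := LocallyCStarAlgebra.exists_cstarAlgebra (A := A) α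
  refine ⟨B, i1, i2, i3, f, hf, ?_⟩
  obtain ⟨D, _, _, _, g, hg, hdense⟩ := exists_cstarAlgebra_of_seminorm (opSeminorm A X α)
    (opBound_mul_le α) (opBound_star α) (opBound_star_mul_self α)
  obtain ⟨d, hd⟩ := CStarAlgebra.nonneg_iff_eq_star_mul_self.1 (hT.map_nonneg g)
  -- The square root `d` need not come from an operator on X, so the closedness of the positive cone
  -- replaces ⟨dx, dx⟩.
  refine CStarAlgebra.isClosed_nonneg.closure_subset (Metric.mem_closure_iff.2 fun ε hε => ?_)
  have hr := barP_nonneg A α x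
  obtain ⟨b, hb⟩ := hdense.exists_mem_open
    -- The error in ⟨Tx, x⟩ is at most ‖b⋆b - T‖ times `barP A α x ^ 2`; the added 1 keeps the
    -- divisor positive.
    (s := {e | ‖star e * e - star d * d‖ < ε / (barP A α x ^ 2 + 1)})
    (isOpen_lt (by fun_prop) continuous_const)
    ⟨d, by
      change ‖star d * d - star d * d‖ < _
      rw [sub_self, norm_zero]
      positivity⟩
  change ‖star (g b) * g b - star d * d‖ < _ at hb
  rw [← hd, ← map_star, ← map_mul, ← map_sub, hg] at hb
  refine ⟨f (ip ((b : Module.End Aᵐᵒᵖ X) x) ((b : Module.End Aᵐᵒᵖ X) x)),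
    map_ip_self_nonneg f _, ?_⟩
  have e : (ip ((b : Module.End Aᵐᵒᵖ X) x) ((b : Module.End Aᵐᵒᵖ X) x) : A)
      - ip ((T : Module.End Aᵐᵒᵖ X) x) x
      = ip (((star b * b - T : AdjointableEnd A X) : Module.End Aᵐᵒᵖ X) x) x := by
    change _ = (ip (((star b : AdjointableEnd A X) : Module.End Aᵐᵒᵖ X)
      ((b : Module.End Aᵐᵒᵖ X) x) - (T : Module.End Aᵐᵒᵖ X) x) x : A)
    rw [sub_eq_add_neg, sub_eq_add_neg, ip_add_left, ip_neg_left, (isAdjointPair_star b).symm]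
  rw [dist_comm, dist_eq_norm, ← map_sub, e, hf]
  have h1 := (P_ip_le (A := A) α (((star b * b - T : AdjointableEnd A X) : Module.End Aᵐᵒᵖ X) x)
    x).trans (mul_le_mul_of_nonneg_right (le_opBound α _ x) hr)
  refine h1.trans_lt ?_
  rw [lt_div_iff₀ (by positivity)] at hb
  change opBound α (star b * b - T) * _ < ε at hb
  nlinarith [opBound_nonneg α (star b * b - T)]

end AdjointableEnd

end PreHilbertModule

theorem proposition3p2 {Δ A X : Type*} [Ring A] [StarRing A] [Algebra ℂ A] [StarModule ℂ A]
    [LocallyCStarAlgebra Δ A]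
    [AddCommGroup X] [Module ℂ X] [Module Aᵐᵒᵖ X] [IsScalarTower ℂ Aᵐᵒᵖ X] [HilbertModule A X]
    (T : Module.End Aᵐᵒᵖ X) :
    (∃ h : T ∈ PreHilbertModule.AdjointableEnd A X,
      IsPositiveElement (⟨T, h⟩ : PreHilbertModule.AdjointableEnd A X)) ↔
    ∀ x : X, IsPositiveElement (PreHilbertModule.ip (T x) x : A) :=
  ⟨fun ⟨_, h⟩ => PreHilbertModule.AdjointableEnd.isPositiveElement_ip h,
    PreHilbertModule.isPositiveElement_of_forall_ip⟩
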